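/- Let $I$ be a finite set. For each $i\in I$ let $\Phi^{(i)}=(f^{(i)}_1,\dots,f^{(i)}_{k_i})$ be a homogeneous iterated function system on $\mathbb C$, $f^{(i)}_j(z)=\lambda_i z+t^{(i)}_j$, with $\lambda_i,t^{(i)}_j\in\mathbb C$ and $0<|\lambda_i|<1$, and let $p_i=(p^{(i)}_1,\dots,p^{(i)}_{k_i})$ be a probability vector with strictly positive entries. Let $\Omega=I^{\mathbb N}$, let $T:\Omega\to\Omega$ be the left shift, and let $\mathbb P$ be a Borel probability measure on $\Omega$ (the selection measure of the planar model $\Sigma=((\Phi^{(i)})_{i\in I},(p_i)_{i\in I},\mathbb P)$). For $\omega=(\omega_1,\omega_2,\dots)\in\Omega$ let $\mathbb X^{(\omega)}_\infty=\prod_{n=1}^\infty\{1,\dots,k_{\omega_n}\}$, let $$\Pi_\omega:\mathbb X^{(\omega)}_\infty\to\mathbb C,\qquad \Pi_\omega(u)=\lim_{n\to\infty}f^{(\omega_1)}_{u_1}\circ\cdots\circ f^{(\omega_n)}_{u_n}(0)=\sum_{n=1}^\infty\Big(\prod_{j=1}^{n-1}\lambda_{\omega_j}\Big)t^{(\omega_n)}_{u_n},$$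 and let $\eta^{(\omega)}$ be the image of the product measure $\bigotimes_{n=1}^\infty p_{\omega_n}$ under $\Pi_\omega$. Suppose that $\mathbb P$ is $T$-invariant and ergodic. Then there exists $\alpha\in[0,2]$ such that for $\mathbb P$-almost every $\omega\in\Omega$ the measure $\eta^{(\omega)}$ has exact dimension $\alpha$, i.e. $$\lim_{r\to0^+}\frac{\log\eta^{(\omega)}(B(x,r))}{\log r}=\alpha\qquad\text{for }\eta^{(\omega)}\text{-almost every }x\in\mathbb C,$$ where $B(x,r)$ is the closed disc of radius $r$ centred at $x$. -/

import Mathlib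

open MeasureTheory Filter Topology

noncomputable section

/-- A planar model `Σ = ((Φ⁽ⁱ⁾)_{i ∈ I}, (p_i)_{i ∈ I}, ℙ)`: for each `i ∈ I` a homogeneous,
orientation preserving, contracting iterated function system on `ℂ`
consisting of the `k i` maps `z ↦ lam i * z + t i j`, a strictly positive probability vector on the
indices of these maps, and a (Borel) probability measure `ℙ` on `Ω = I^ℕ`. The coordinates of
sequences are numbered from `0`. -/
structure PlanarModel (I : Type*) [MeasurableSpace I] where
  /-- number of maps in the `i`-th system -/
  k : I → ℕ
  /-- common linear part of the maps in the `i`-th system -/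
  lam : I → ℂ
  lam_ne_zero : ∀ i, lam i ≠ 0
  norm_lam_lt_one : ∀ i, ‖lam i‖ < 1
  /-- translation parts -/
  t : (i : I) → Fin (k i) → ℂ
  /-- probability vectors -/
  p : (i : I) → Fin (k i) → ℝ
  p_pos : ∀ i j, 0 < p i j
  p_sum : ∀ i, ∑ j, p i j = 1
  /-- the selection measure -/
  selection : Measure (ℕ → I)
  isProbabilityMeasure_selection : IsProbabilityMeasure selection

/-- The left shift `T` on `I^ℕ`. -/
def leftShift (I : Type*) (ω : ℕ → I) : ℕ → I := fun n => ω (n + 1)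

/-- A Borel measure `μ` on the plane has exact dimension `α` if
`log μ(B(x,r)) / log r → α` as `r → 0⁺`, for `μ`-almost every `x`. -/
def HasExactDimension (μ : Measure ℂ) (α : ℝ) : Prop :=
  ∀ᵐ x ∂μ, Tendsto (fun r : ℝ => Real.log (μ.real (Metric.closedBall x r)) / Real.log r)
    (𝓝[>] 0) (𝓝 α)

namespace PlanarModel

variable {I : Type*} [MeasurableSpace I] (S : PlanarModel I)

/-- The map `f_j⁽ⁱ⁾(z) = λ_i z + t_j⁽ⁱ⁾`. -/
def f (i : I) (j : Fin (S.k i)) (z : ℂ) : ℂ := S.lam i * z + S.t i j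

/-- The space `𝕏_∞^{(ω)} = ∏_n {1, …, k_{ω_n}}` of infinite words. -/
abbrev Words (ω : ℕ → I) : Type := (n : ℕ) → Fin (S.k (ω n))

/-- The composition `f_{u|n}^{(ω)} = f_{u_1}^{(ω_1)} ∘ ⋯ ∘ f_{u_n}^{(ω_n)}`. -/
def comp (ω : ℕ → I) (u : S.Words ω) : ℕ → ℂ → ℂ
  | 0 => id
  | n + 1 => comp ω u n ∘ S.f (ω n) (u n)

/-- The coding map `Π_ω(u) = ∑_n (∏_{j < n} λ_{ω_j}) t_{u_n}^{(ω_n)}`. It is the limit of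
`f_{u|n}^{(ω)}(0)`, see `tendsto_comp` below. -/
def coding (ω : ℕ → I) (u : S.Words ω) : ℂ :=
  ∑' n, (∏ j ∈ Finset.range n, S.lam (ω j)) * S.t (ω n) (u n)

/-- The probability vector `p_i`, as a measure on `{1, …, k_i}`. -/
def probMeasure (i : I) : Measure (Fin (S.k i)) :=
  ∑ j, ENNReal.ofReal (S.p i j) • Measure.dirac j

instance (i : I) : IsProbabilityMeasure (S.probMeasure i) := by
  constructor
  simp only [probMeasure, Measure.coe_finsetSum, Finset.sum_apply, Measure.smul_apply,
    measure_univ, smul_eq_mul, mul_one]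
  rw [← ENNReal.ofReal_sum_of_nonneg fun j _ => (S.p_pos i j).le, S.p_sum, ENNReal.ofReal_one]

/-- The product measure `⨂_n p_{ω_n}` on `𝕏_∞^{(ω)}`. -/
def wordMeasure (ω : ℕ → I) : Measure (S.Words ω) :=
  Measure.infinitePi fun n => S.probMeasure (ω n)

/-- The random measure `η^{(ω)}`: the image of `⨂_n p_{ω_n}` under the coding map `Π_ω`. -/
def randomMeasure (ω : ℕ → I) : Measure ℂ :=
  (S.wordMeasure ω).map (S.coding ω)

theorem exists_summable_bound [Finite I] : ∃ C ρ : ℝ, 0 ≤ ρ ∧ ρ < 1 ∧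
    ∀ (ω : ℕ → I) (u : S.Words ω) (n : ℕ),
      ‖(∏ j ∈ Finset.range n, S.lam (ω j)) * S.t (ω n) (u n)‖ ≤ C * ρ ^ n := by
  cases nonempty_fintype I
  obtain ⟨C, hC⟩ := (Set.finite_range fun x : (Σ i, Fin (S.k i)) => ‖S.t x.1 x.2‖).bddAbove
  rcases isEmpty_or_nonempty I with hI | hI
  · exact ⟨0, 0, le_rfl, one_pos, fun ω => (hI.false (ω 0)).elim⟩
  obtain ⟨i₀, hi₀⟩ := Finite.exists_max fun i => ‖S.lam i‖
  refine ⟨C, ‖S.lam i₀‖, norm_nonneg _, S.norm_lam_lt_one _, fun ω u n => ?_⟩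
  have h1 : ‖S.t (ω n) (u n)‖ ≤ C := hC ⟨⟨ω n, u n⟩, rfl⟩
  have h2 : ∏ j ∈ Finset.range n, ‖S.lam (ω j)‖ ≤ ‖S.lam i₀‖ ^ n := by
    calc _ ≤ ∏ _j ∈ Finset.range n, ‖S.lam i₀‖ :=
          Finset.prod_le_prod (fun _ _ => norm_nonneg _) fun _ _ => hi₀ _
      _ = _ := by simp
  rw [norm_mul, norm_prod, mul_comm C]
  exact mul_le_mul h2 h1 (norm_nonneg _) (by positivity)

theorem summable_coding [Finite I] (ω : ℕ → I) (u : S.Words ω) :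
    Summable fun n => (∏ j ∈ Finset.range n, S.lam (ω j)) * S.t (ω n) (u n) := by
  obtain ⟨C, ρ, h0, h1, h⟩ := S.exists_summable_bound
  exact Summable.of_norm_bounded ((summable_geometric_of_lt_one h0 h1).mul_left C) (h ω u)

theorem comp_apply (ω : ℕ → I) (u : S.Words ω) (n : ℕ) (z : ℂ) :
    S.comp ω u n z = (∏ j ∈ Finset.range n, S.lam (ω j)) * z +
      ∑ m ∈ Finset.range n, (∏ j ∈ Finset.range m, S.lam (ω j)) * S.t (ω m) (u m) := by
  induction n generalizing z with
  | zero => simp [comp]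
  | succ n ih =>
    simp only [comp, Function.comp_apply, ih, f, Finset.prod_range_succ, Finset.sum_range_succ]
    ring

/-- The coding map is the limit of `f_{u|n}^{(ω)}(0)`. -/
theorem tendsto_comp [Finite I] (ω : ℕ → I) (u : S.Words ω) :
    Tendsto (fun n => S.comp ω u n 0) atTop (𝓝 (S.coding ω u)) := by
  simpa [comp_apply, coding] using (S.summable_coding ω u).hasSum.tendsto_sum_nat

theorem measurable_coding [Finite I] (ω : ℕ → I) : Measurable (S.coding ω) := by
  refine measurable_of_tendsto_metrizable (f := fun n u => S.comp ω u n 0) (fun n => ?_)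
    (tendsto_pi_nhds.2 fun u => S.tendsto_comp ω u)
  simp only [comp_apply]
  refine measurable_const.add (Finset.measurable_fun_sum _ fun m _ => ?_)
  exact ((measurable_of_countable (S.t (ω m))).comp (measurable_pi_apply m)).const_mul _

instance [Finite I] (ω : ℕ → I) : IsProbabilityMeasure (S.randomMeasure ω) := by
  have : IsProbabilityMeasure (S.wordMeasure ω) := by unfold wordMeasure; infer_instance
  exact Measure.isProbabilityMeasure_map (S.measurable_coding ω).aemeasurable

end PlanarModel

end

/-!
The measures `η^{(ω)}` are dynamically self-similar, and the classical argument for exact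
dimensionality of self-similar measures satisfying no separation condition applies along the orbit
of `ω`.

Words are realised for all `ω` on one probability space: `v` is an independent sequence of families
of letters, one letter for each system, and `(ω, v)` codes the point `x = Π_ω(u)` with
`u_n = v_n(ω_n)`. The map `(ω, v) ↦ (Tω, σv)` is ergodic, being the product of an ergodic map and a
Bernoulli shift (`Ergodic.prodMap_leftShift`). Since the maps are similarities,
`η^{(ω)}(B(x, |λ_{ω_0}| r))`, restricted to words with the same first letter as `u`, equals
`p_{u_0} η^{(Tω)}(B(x', r))`, where `x'` is coded by the shifted pair
(`PlanarModel.letterBallMass_succ`). Iterating this relation with `r_n = R |λ_{ω_0} ⋯ λ_{ω_{n-1}}|`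
gives
`log η^{(ω)}(B(x, r_n)) = ∑_{k<n} (log p - g_{n-k}) ∘ (T × σ)^k`,
where `g_m` is the logarithm of the conditional probability of the first letter in the ball of
radius `r_m` (`PlanarModel.log_ballMass_eq_sum`). Differentiation of measures shows that `g_m`
converges almost surely, and a maximal inequality obtained from the Besicovitch covering theorem
(`exists_measure_exists_closedBall_le`) shows that `sup_m |g_m|` is integrable. So Maker's version
of Birkhoff's theorem (`Ergodic.ae_tendsto_sum_sub_div`, deduced here from the maximal ergodic
inequality) applies: `log η^{(ω)}(B(x, r_n)) / n` converges almost surely to a constant `a`.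
By Birkhoff's theorem `log r_n / n` tends to the constant `b = ∫ log |λ_{ω_0}| < 0`, and as the
scales decay regularly the local dimension of `η^{(ω)}` at `x` is `a / b`
(`tendsto_log_div_log_of_seq`). It is at most `2` by differentiation of Lebesgue measure with
respect to `η^{(ω)}` (`HasExactDimension.mem_Icc`).
-/

open MeasureTheory Filter Topology

noncomputable section

/-! ### Pointwise ergodic theorems -/

section ErgodicTheorems

variable {X : Type*} {T : X → X}

/-- The maximum of `0` and the first `n` nonempty Birkhoff sums of `g`, in the recursive form
`max 0 (g + M_n ∘ T)`. -/
def maxBirkhoffSum (T : X → X) (g : X → ℝ) : ℕ → X → ℝ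
  | 0, _ => 0
  | n + 1, x => max 0 (g x + maxBirkhoffSum T g n (T x))

theorem maxBirkhoffSum_nonneg (g : X → ℝ) (n : ℕ) (x : X) : 0 ≤ maxBirkhoffSum T g n x := by
  cases n with
  | zero => exact le_rfl
  | succ n => exact le_max_left _ _

theorem birkhoffSum_le_maxBirkhoffSum (g : X → ℝ) (n : ℕ) (x : X) :
    birkhoffSum T g n x ≤ maxBirkhoffSum T g n x := by
  induction n generalizing x with
  | zero => simp [maxBirkhoffSum]
  | succ n ih =>
    rw [birkhoffSum_succ']
    exact le_trans (by gcongr; exact ih _) (le_max_right _ _)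

theorem maxBirkhoffSum_le_succ (g : X → ℝ) (n : ℕ) (x : X) :
    maxBirkhoffSum T g n x ≤ maxBirkhoffSum T g (n + 1) x := by
  induction n generalizing x with
  | zero => exact maxBirkhoffSum_nonneg _ _ _
  | succ n ih =>
    change max 0 (g x + maxBirkhoffSum T g n (T x)) ≤ max 0 (g x + maxBirkhoffSum T g (n + 1) (T x))
    gcongr
    exact ih _

theorem monotone_maxBirkhoffSum (g : X → ℝ) (x : X) :
    Monotone fun n => maxBirkhoffSum T g n x :=
  monotone_nat_of_le_succ fun n => maxBirkhoffSum_le_succ g n x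

variable [MeasurableSpace X] {μ : Measure X}

theorem measurable_maxBirkhoffSum (hT : Measurable T) {g : X → ℝ} (hg : Measurable g) (n : ℕ) :
    Measurable (maxBirkhoffSum T g n) := by
  induction n with
  | zero => exact measurable_const
  | succ n ih => exact measurable_const.max (hg.add (ih.comp hT))

theorem integrable_maxBirkhoffSum (hT : MeasurePreserving T μ μ) {g : X → ℝ}
    (hg : Integrable g μ) (n : ℕ) : Integrable (maxBirkhoffSum T g n) μ := by
  induction n with
  | zero => exact integrable_zero _ _ _
  | succ n ih =>
    exact (integrable_zero _ _ _).sup (hg.add (hT.integrable_comp_of_integrable ih))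

/-- **Maximal ergodic inequality.** -/
theorem setIntegral_maxBirkhoffSum_pos_nonneg (hT : MeasurePreserving T μ μ) {g : X → ℝ}
    (hgm : Measurable g) (hg : Integrable g μ) (n : ℕ) :
    0 ≤ ∫ x in {x | 0 < maxBirkhoffSum T g n x}, g x ∂μ := by
  cases n with
  | zero => simp [maxBirkhoffSum]
  | succ n =>
    set A := {x | 0 < maxBirkhoffSum T g (n + 1) x}
    have hA : MeasurableSet A :=
      measurableSet_lt measurable_const (measurable_maxBirkhoffSum hT.measurable hgm _)
    have h1 := integrable_maxBirkhoffSum hT hg (n + 1)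
    have h0 := integrable_maxBirkhoffSum hT hg n
    have h0' : Integrable (fun x => maxBirkhoffSum T g n (T x)) μ :=
      hT.integrable_comp_of_integrable h0
    have e1 : ∫ x in A, g x ∂μ = ∫ x in A, maxBirkhoffSum T g (n + 1) x ∂μ
        - ∫ x in A, maxBirkhoffSum T g n (T x) ∂μ := by
      rw [← integral_sub h1.integrableOn h0'.integrableOn]
      refine setIntegral_congr_fun hA fun x hx => ?_
      have hx' : 0 < max 0 (g x + maxBirkhoffSum T g n (T x)) := hx
      have : 0 < g x + maxBirkhoffSum T g n (T x) := by simpa using hx'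
      change g x = max 0 (g x + maxBirkhoffSum T g n (T x)) - maxBirkhoffSum T g n (T x)
      rw [max_eq_right this.le]; ring
    have e2 : ∫ x in A, maxBirkhoffSum T g (n + 1) x ∂μ = ∫ x, maxBirkhoffSum T g (n + 1) x ∂μ := by
      refine setIntegral_eq_integral_of_forall_compl_eq_zero fun x hx => ?_
      exact le_antisymm (not_lt.1 hx) (maxBirkhoffSum_nonneg _ _ _)
    have e3 : ∫ x in A, maxBirkhoffSum T g n (T x) ∂μ ≤ ∫ x, maxBirkhoffSum T g n (T x) ∂μ :=
      setIntegral_le_integral h0' (Eventually.of_forall fun x => maxBirkhoffSum_nonneg _ _ _)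
    have e4 : ∫ x, maxBirkhoffSum T g n (T x) ∂μ = ∫ x, maxBirkhoffSum T g n x ∂μ := by
      have hae := (measurable_maxBirkhoffSum hT.measurable hgm n).aestronglyMeasurable
        (μ := μ.map T)
      rw [← integral_map hT.measurable.aemeasurable hae, hT.map_eq]
    have e5 : ∫ x, maxBirkhoffSum T g n x ∂μ ≤ ∫ x, maxBirkhoffSum T g (n + 1) x ∂μ :=
      integral_mono h0 h1 fun x => maxBirkhoffSum_le_succ g n x
    linarith

theorem measurable_birkhoffSum (hT : Measurable T) {g : X → ℝ} (hg : Measurable g) (n : ℕ) :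
    Measurable (birkhoffSum T g n) :=
  Finset.measurable_fun_sum _ fun k _ => hg.comp (hT.iterate k)

/-- If `∫ g < 0` and `T` is ergodic, the Birkhoff sums of `g` are almost surely bounded above. The
set where they are is invariant; were it null, the maximal inequality would give `0 ≤ ∫ g`. -/
theorem Ergodic.ae_bddAbove_birkhoffSum [IsProbabilityMeasure μ] (hT : Ergodic T μ) {g : X → ℝ}
    (hgm : Measurable g) (hg : Integrable g μ) (hneg : ∫ x, g x ∂μ < 0) :
    ∀ᵐ x ∂μ, BddAbove (Set.range fun n => birkhoffSum T g n x) := by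
  set E := {x | BddAbove (Set.range fun n => birkhoffSum T g n x)}
  have hE : MeasurableSet E :=
    measurableSet_bddAbove_range fun n => measurable_birkhoffSum hT.measurable hgm n
  have hinv : T ⁻¹' E = E := by
    ext x
    simp only [E, Set.mem_preimage, Set.mem_ofPred_eq, bddAbove_def, Set.forall_mem_range]
    constructor
    · rintro ⟨B, hB⟩
      refine ⟨max 0 (g x + B), fun n => ?_⟩
      cases n with
      | zero => simp
      | succ n => rw [birkhoffSum_succ']; exact le_max_of_le_right (by linarith [hB n])
    · rintro ⟨B, hB⟩
      refine ⟨B - g x, fun n => ?_⟩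
      have := hB (n + 1)
      rw [birkhoffSum_succ'] at this
      linarith
  rcases hT.toPreErgodic.ae_mem_or_ae_notMem hE hinv with h | h
  · exact h
  exfalso
  have hmono : Monotone fun n => {x | 0 < maxBirkhoffSum T g n x} := fun m n hmn x hx =>
    lt_of_lt_of_le hx (monotone_maxBirkhoffSum g x hmn)
  have hlim := tendsto_setIntegral_of_monotone (μ := μ) (f := g) (fun n => measurableSet_lt
    measurable_const (measurable_maxBirkhoffSum hT.measurable hgm n)) hmono hg.integrableOn
  have hfull : (⋃ n, {x | 0 < maxBirkhoffSum T g n x}) =ᵐ[μ] (Set.univ : Set X) := by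
    rw [eventuallyEq_univ]
    filter_upwards [h] with x hx
    by_contra hcon
    refine hx ⟨0, Set.forall_mem_range.2 fun n => ?_⟩
    simp only [Set.mem_iUnion, Set.mem_ofPred_eq, not_exists, not_lt] at hcon
    exact (birkhoffSum_le_maxBirkhoffSum g n x).trans (hcon n)
  rw [setIntegral_congr_set hfull, setIntegral_univ] at hlim
  exact absurd (ge_of_tendsto' hlim fun n =>
    setIntegral_maxBirkhoffSum_pos_nonneg hT.toMeasurePreserving hgm hg n) (not_le.2 hneg)

theorem Ergodic.ae_eventually_birkhoffSum_le [IsProbabilityMeasure μ] (hT : Ergodic T μ)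
    {g : X → ℝ} (hgm : Measurable g) (hg : Integrable g μ) {c : ℝ} (hc : ∫ x, g x ∂μ < c) :
    ∀ᵐ x ∂μ, ∀ᶠ n : ℕ in atTop, birkhoffSum T g n x / n < c := by
  obtain ⟨b, hb, hbc⟩ := exists_between hc
  have hint : Integrable (fun x => g x - b) μ := hg.sub (integrable_const _)
  have h := hT.ae_bddAbove_birkhoffSum (hgm.sub_const b) hint (by
    rw [integral_sub hg (integrable_const _)]; simpa using hb)
  filter_upwards [h] with x ⟨B, hB⟩
  have hlim : Tendsto (fun n : ℕ => b + B / n) atTop (𝓝 (b + 0)) :=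
    (tendsto_const_div_atTop_nhds_zero_nat B).const_add b
  filter_upwards [hlim.eventually_lt_const (by simpa using hbc), eventually_gt_atTop 0] with n hn h0
  have h0' : (0 : ℝ) < n := by exact_mod_cast h0
  refine lt_of_le_of_lt ?_ hn
  have := hB ⟨n, rfl⟩
  simp only [birkhoffSum, Finset.sum_sub_distrib, Finset.sum_const, Finset.card_range,
    nsmul_eq_mul] at this ⊢
  rw [div_le_iff₀ h0', add_mul, div_mul_cancel₀ _ h0'.ne']
  linarith

/-- **Birkhoff's ergodic theorem** for ergodic transformations. -/
theorem Ergodic.ae_tendsto_birkhoffSum_div [IsProbabilityMeasure μ] (hT : Ergodic T μ)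
    {g : X → ℝ} (hgm : Measurable g) (hg : Integrable g μ) :
    ∀ᵐ x ∂μ, Tendsto (fun n : ℕ => birkhoffSum T g n x / n) atTop (𝓝 (∫ x, g x ∂μ)) := by
  have h1 : ∀ᵐ x ∂μ, ∀ m : ℕ, ∀ᶠ n : ℕ in atTop,
      birkhoffSum T g n x / n < ∫ x, g x ∂μ + 1 / ((m : ℝ) + 1) :=
    ae_all_iff.2 fun m => hT.ae_eventually_birkhoffSum_le hgm hg (by
      have : (0 : ℝ) < 1 / ((m : ℝ) + 1) := by positivity
      linarith)
  have h2 : ∀ᵐ x ∂μ, ∀ m : ℕ, ∀ᶠ n : ℕ in atTop,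
      birkhoffSum T (fun x => -g x) n x / n < -∫ x, g x ∂μ + 1 / ((m : ℝ) + 1) :=
    ae_all_iff.2 fun m => hT.ae_eventually_birkhoffSum_le hgm.neg hg.neg (by
      have : (0 : ℝ) < 1 / ((m : ℝ) + 1) := by positivity
      simp only [Pi.neg_apply, integral_neg]
      linarith)
  filter_upwards [h1, h2] with x h1 h2
  refine Metric.tendsto_nhds.2 fun ε hε => ?_
  obtain ⟨m, hm⟩ := exists_nat_one_div_lt hε
  filter_upwards [h1 m, h2 m] with n hn1 hn2
  rw [Real.dist_eq, abs_lt]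
  simp only [birkhoffSum, Finset.sum_neg_distrib, neg_div] at hn1 hn2 ⊢
  constructor <;> linarith

/-- **Maker's ergodic theorem** for ergodic transformations: Birkhoff averages in which the
function at time `k` is `F (n - k)`, for a dominated almost surely convergent sequence `F`. -/
theorem Ergodic.ae_tendsto_sum_sub_div [IsProbabilityMeasure μ] (hT : Ergodic T μ)
    {F : ℕ → X → ℝ} {F' G : X → ℝ} (hFm : ∀ n, Measurable (F n)) (hF'm : Measurable F')
    (hGm : Measurable G) (hG : Integrable G μ) (hFG : ∀ᵐ x ∂μ, ∀ n, |F n x| ≤ G x)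
    (hlim : ∀ᵐ x ∂μ, Tendsto (fun n => F n x) atTop (𝓝 (F' x))) :
    ∀ᵐ x ∂μ, Tendsto (fun n : ℕ => (∑ k ∈ Finset.range n, F (n - k) (T^[k] x)) / n) atTop
      (𝓝 (∫ x, F' x ∂μ)) := by
  have hF'G : ∀ᵐ x ∂μ, |F' x| ≤ G x := by
    filter_upwards [hFG, hlim] with x h1 h2 using le_of_tendsto' h2.abs h1
  have hF' : Integrable F' μ := hG.mono' hF'm.aestronglyMeasurable (by simpa using hF'G)
  have hD : ∀ᵐ x ∂μ, ∀ n, |F n x - F' x| ≤ 2 * G x := by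
    filter_upwards [hFG, hF'G] with x h1 h2 n
    linarith [abs_sub (F n x) (F' x), h1 n]
  -- `U N` is the supremum of the errors `|F n - F'|` over `n ≥ N`
  let U : ℕ → X → ℝ := fun N x => ⨆ m, |F (N + m) x - F' x|
  have hUm : ∀ N, Measurable (U N) := fun N => Measurable.iSup fun m => ((hFm _).sub hF'm).abs
  have hUle : ∀ᵐ x ∂μ, ∀ N n, N ≤ n → |F n x - F' x| ≤ U N x := by
    filter_upwards [hD] with x hx N n hn
    obtain ⟨m, rfl⟩ := Nat.exists_eq_add_of_le hn
    exact le_ciSup (f := fun m => |F (N + m) x - F' x|)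
      ⟨2 * G x, Set.forall_mem_range.2 fun m => hx _⟩ m
  have hU0 : ∀ N x, 0 ≤ U N x := fun N x => Real.iSup_nonneg fun m => abs_nonneg _
  have hUG : ∀ N, ∀ᵐ x ∂μ, ‖U N x‖ ≤ 2 * G x := by
    intro N
    filter_upwards [hD] with x hx
    rw [Real.norm_of_nonneg (hU0 N x)]
    exact ciSup_le fun m => hx _
  have hUint : ∀ N, Integrable (U N) μ := fun N =>
    (hG.const_mul 2).mono' (hUm N).aestronglyMeasurable (hUG N)
  have hUlim : Tendsto (fun N => ∫ x, U N x ∂μ) atTop (𝓝 0) := by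
    have := tendsto_integral_of_dominated_convergence (μ := μ) (F := U) (f := fun _ => (0 : ℝ))
      (fun x => 2 * G x) (fun N => (hUm N).aestronglyMeasurable) (hG.const_mul 2) hUG (by
        filter_upwards [hlim] with x hx
        refine Metric.tendsto_atTop.2 fun ε hε => ?_
        obtain ⟨N, hN⟩ := Metric.tendsto_atTop.1 hx (ε / 2) (half_pos hε)
        refine ⟨N, fun n hn => ?_⟩
        rw [Real.dist_0_eq_abs, abs_of_nonneg (hU0 n x)]
        refine lt_of_le_of_lt (ciSup_le fun m => ?_) (half_lt_self hε)
        exact (hN (n + m) (by omega)).le)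
    simpa using this
  have hiter : ∀ {p : X → Prop}, (∀ᵐ x ∂μ, p x) → ∀ᵐ x ∂μ, ∀ k : ℕ, p (T^[k] x) := fun hp =>
    ae_all_iff.2 fun k => (hT.toMeasurePreserving.iterate k).quasiMeasurePreserving.ae hp
  have hUB : ∀ᵐ x ∂μ, ∀ N, Tendsto (fun n : ℕ => birkhoffSum T (U N) n x / n) atTop
      (𝓝 (∫ x, U N x ∂μ)) :=
    ae_all_iff.2 fun N => hT.ae_tendsto_birkhoffSum_div (hUm N) (hUint N)
  filter_upwards [hT.ae_tendsto_birkhoffSum_div hF'm hF', hUB,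
    hT.ae_tendsto_birkhoffSum_div (hGm.const_mul 2) (hG.const_mul 2), hiter hD, hiter hUle]
    with x hF'x hUx hGx hDx hUlex
  set S := birkhoffSum T (fun x => 2 * G x) with hS
  have hbound : ∀ N n : ℕ, N ≤ n →
      |∑ k ∈ Finset.range n, F (n - k) (T^[k] x) - birkhoffSum T F' n x| ≤
        birkhoffSum T (U N) n x + (S n x - S (n - N) x) := by
    intro N n hn
    have e : S n x - S (n - N) x = ∑ k ∈ Finset.range n,
        if n - N ≤ k then 2 * G (T^[k] x) else 0 := by
      rw [← Finset.sum_filter, sub_eq_iff_eq_add, hS, birkhoffSum, birkhoffSum,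
        ← Finset.sum_filter_add_sum_filter_not (Finset.range n) (fun k => n - N ≤ k)]
      congr 2
      ext k
      simp
      omega
    rw [e, birkhoffSum, birkhoffSum, ← Finset.sum_sub_distrib, ← Finset.sum_add_distrib]
    refine (Finset.abs_sum_le_sum_abs _ _).trans (Finset.sum_le_sum fun k hk => ?_)
    have hk := Finset.mem_range.1 hk
    split_ifs with h
    · linarith [hDx k (n - k), hU0 N (T^[k] x)]
    · linarith [hUlex k N (n - k) (by omega)]
  have hshift : ∀ N : ℕ, Tendsto (fun n : ℕ => (S n x - S (n - N) x) / n) atTop (𝓝 0) := by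
    intro N
    have h1 : Tendsto (fun n : ℕ => S (n - N) x / ((n - N : ℕ) : ℝ)) atTop
      (𝓝 (∫ x, 2 * G x ∂μ)) := hGx.comp (tendsto_sub_atTop_nat N)
    have h2 : Tendsto (fun n : ℕ => ((n - N : ℕ) : ℝ) / n) atTop (𝓝 1) := by
      have : Tendsto (fun n : ℕ => 1 - (N : ℝ) / n) atTop (𝓝 (1 - 0)) :=
        (tendsto_const_div_atTop_nhds_zero_nat (N : ℝ)).const_sub 1
      rw [sub_zero] at this
      refine this.congr' ?_
      filter_upwards [eventually_gt_atTop N] with n hn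
      have : (n : ℝ) ≠ 0 := by norm_cast; omega
      rw [Nat.cast_sub hn.le]
      field_simp
    have h3 := hGx.sub (h1.mul h2)
    rw [mul_one, sub_self] at h3
    refine h3.congr' ?_
    filter_upwards [eventually_gt_atTop N] with n hn
    have : ((n - N : ℕ) : ℝ) ≠ 0 := by norm_cast; omega
    rw [div_mul_div_cancel₀ this, sub_div]
  have hdiff : Tendsto (fun n : ℕ =>
      (∑ k ∈ Finset.range n, F (n - k) (T^[k] x) - birkhoffSum T F' n x) / n) atTop (𝓝 0) := by
    refine Metric.tendsto_nhds.2 fun ε hε => ?_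
    obtain ⟨N, hN⟩ := (hUlim.eventually_lt_const hε).exists
    have h := (hUx N).add (hshift N)
    rw [add_zero] at h
    filter_upwards [h.eventually_lt_const hN, eventually_ge_atTop N] with n h1 h2
    rw [Real.dist_0_eq_abs, abs_div, Nat.abs_cast]
    refine lt_of_le_of_lt ?_ h1
    rw [← add_div]
    exact div_le_div_of_nonneg_right (hbound N n h2) n.cast_nonneg
  have := hdiff.add hF'x
  rw [zero_add] at this
  refine this.congr fun n => ?_
  rw [← add_div, sub_add_cancel]

end ErgodicTheorems

/-! ### Products of an ergodic map with a Bernoulli shift -/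

section Bernoulli

variable {A : Type*} [MeasurableSpace A]

theorem measurable_leftShift : Measurable (leftShift A) :=
  measurable_pi_iff.2 fun n => measurable_pi_apply (n + 1)

theorem leftShift_iterate_apply {A : Type*} (n k : ℕ) (v : ℕ → A) :
    (leftShift A)^[n] v k = v (k + n) := by
  induction n generalizing k with
  | zero => rfl
  | succ n ih => rw [Function.iterate_succ_apply', leftShift, ih, add_right_comm, add_assoc]

variable (m : Measure A) [IsProbabilityMeasure m]

theorem measurePreserving_leftShift :
    MeasurePreserving (leftShift A) (Measure.infinitePi fun _ : ℕ => m)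
      (Measure.infinitePi fun _ : ℕ => m) :=
  ⟨measurable_leftShift,
    Measure.map_infinitePi_infinitePi_of_inj (P := fun _ : ℕ => m) (add_left_injective 1)⟩

theorem iIndep_comap_eval_infinitePi :
    ProbabilityTheory.iIndep
      (fun n : ℕ => MeasurableSpace.comap (fun v : ℕ → A => v n) inferInstance)
      (Measure.infinitePi fun _ : ℕ => m) :=
  (ProbabilityTheory.iIndepFun_infinitePi (P := fun _ : ℕ => m) (X := fun _ a => a)
    fun _ => measurable_id).iIndep

/-- The iterate `σ^n` of the shift is measurable with respect to the coordinates from `n` on. -/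
theorem measurableSet_iSup_comap_eval_preimage_iterate (n : ℕ) {B : Set (ℕ → A)}
    (hB : MeasurableSet B) :
    MeasurableSet[⨆ i ∈ Set.Ici n, MeasurableSpace.comap (fun v : ℕ → A => v i) inferInstance]
      ((leftShift A)^[n] ⁻¹' B) := by
  have h : MeasurableSpace.comap (leftShift A)^[n] MeasurableSpace.pi ≤
      ⨆ i ∈ Set.Ici n, MeasurableSpace.comap (fun v : ℕ → A => v i) inferInstance := by
    rw [MeasurableSpace.pi, MeasurableSpace.comap_iSup]
    refine iSup_le fun k => ?_
    rw [MeasurableSpace.comap_comp]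
    have e : (fun v : ℕ → A => v k) ∘ (leftShift A)^[n] = fun v => v (k + n) :=
      funext fun v => leftShift_iterate_apply n k v
    rw [e]
    exact le_iSup₂_of_le (k + n) (Nat.le_add_left n k) le_rfl
  exact h _ ⟨B, hB, rfl⟩

/-- Under a Bernoulli measure the first coordinate is independent of the shifted sequence. -/
theorem infinitePi_eval_zero_inter_leftShift {a : Set A} (ha : MeasurableSet a)
    {B : Set (ℕ → A)} (hB : MeasurableSet B) :
    Measure.infinitePi (fun _ : ℕ => m) {v | v 0 ∈ a ∧ leftShift A v ∈ B} =
      m a * Measure.infinitePi (fun _ : ℕ => m) B := by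
  have hind := ProbabilityTheory.indep_iSup_of_disjoint
    (fun n => (measurable_pi_apply n).comap_le) (iIndep_comap_eval_infinitePi m)
    (S := {0}) (T := Set.Ici 1) (by simp)
  have h0 : MeasurableSet[⨆ i ∈ ({0} : Set ℕ),
      MeasurableSpace.comap (fun v : ℕ → A => v i) inferInstance] {v | v 0 ∈ a} := by
    have hle : MeasurableSpace.comap (fun v : ℕ → A => v 0) inferInstance ≤
        ⨆ i ∈ ({0} : Set ℕ), MeasurableSpace.comap (fun v : ℕ → A => v i) inferInstance :=
      le_iSup₂_of_le 0 rfl le_rfl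
    exact hle _ ⟨a, ha, rfl⟩
  have h1 := measurableSet_iSup_comap_eval_preimage_iterate 1 hB
  have h := (ProbabilityTheory.Indep_iff _ _ _).1 hind _ _ h0 h1
  have e0 : Measure.infinitePi (fun _ : ℕ => m) {v | v 0 ∈ a} = m a :=
    (measurePreserving_eval_infinitePi (fun _ : ℕ => m) 0).measure_preimage ha.nullMeasurableSet
  have e1 : Measure.infinitePi (fun _ : ℕ => m) ((leftShift A)^[1] ⁻¹' B) =
      Measure.infinitePi (fun _ : ℕ => m) B :=
    (measurePreserving_leftShift m).measure_preimage hB.nullMeasurableSet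
  rw [e0, e1] at h
  exact h

/-- The product of an ergodic map with a Bernoulli shift is ergodic. A fibre of an invariant set
is a tail event, hence trivial by Kolmogorov's zero-one law, and the set of base points with full
fibre is invariant under the base map. -/
theorem Ergodic.prodMap_leftShift {Ω : Type*} [MeasurableSpace Ω] {P : Measure Ω}
    [IsProbabilityMeasure P] {T : Ω → Ω} (hT : Ergodic T P) :
    Ergodic (Prod.map T (leftShift A)) (P.prod (Measure.infinitePi fun _ : ℕ => m)) := by
  set ν := Measure.infinitePi fun _ : ℕ => m
  have hmp := hT.toMeasurePreserving.prod (measurePreserving_leftShift m)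
  refine ⟨hmp, ⟨fun s hs hinv => ?_⟩⟩
  have hsec : ∀ ω (n : ℕ),
      Prod.mk ω ⁻¹' s = (leftShift A)^[n] ⁻¹' (Prod.mk (T^[n] ω) ⁻¹' s) := by
    intro ω n
    have h : (Prod.map T (leftShift A))^[n] ⁻¹' s = s :=
      Function.IsFixedPt.preimage_iterate hinv n
    ext v
    nth_rw 1 [← h]
    simp [Prod.map_iterate]
  have h01 : ∀ ω, ν (Prod.mk ω ⁻¹' s) = 0 ∨ ν (Prod.mk ω ⁻¹' s) = 1 := by
    intro ω
    refine ProbabilityTheory.measure_zero_or_one_of_measurableSet_limsup_atTop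
      (fun n => (measurable_pi_apply n).comap_le) (iIndep_comap_eval_infinitePi m) ?_
    rw [limsup_eq_iInf_iSup_of_nat, MeasurableSpace.measurableSet_iInf]
    intro n
    rw [hsec ω n]
    exact measurableSet_iSup_comap_eval_preimage_iterate n (measurable_prodMk_left hs)
  have hmeas : Measurable fun ω => ν (Prod.mk ω ⁻¹' s) := measurable_measure_prodMk_left hs
  have hinvB : T ⁻¹' {ω | ν (Prod.mk ω ⁻¹' s) = 1} = {ω | ν (Prod.mk ω ⁻¹' s) = 1} := by
    ext ω
    have := (measurePreserving_leftShift m).measure_preimage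
      (measurable_prodMk_left (x := T ω) hs).nullMeasurableSet
    have h1 := hsec ω 1
    simp only [Function.iterate_one] at h1
    simp only [Set.mem_preimage, Set.mem_ofPred_eq]
    rw [h1, this]
  have hsnd : ∀ c : ENNReal, (∀ᵐ ω ∂P, ν (Prod.mk ω ⁻¹' s) = c) → P.prod ν s = c := by
    intro c hc
    rw [Measure.prod_apply hs, lintegral_congr_ae hc]
    simp
  rw [eventuallyConst_set']
  rcases hT.toPreErgodic.ae_mem_or_ae_notMem (hmeas (measurableSet_singleton 1)) hinvB with h | h
  · refine Or.inr ?_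
    rw [eventuallyEq_univ, mem_ae_iff, prob_compl_eq_zero_iff hs]
    exact hsnd 1 h
  · refine Or.inl (ae_eq_empty.2 (hsnd 0 ?_))
    filter_upwards [h] with ω hω using (h01 ω).resolve_right hω

end Bernoulli

/-! ### Masses of small balls -/

section Balls

/-- A maximal inequality in a space with the Besicovitch covering property: the points at which
some ball has `ρ`-mass at most `ε` times its `η`-mass form a set of `ρ`-measure `O(ε)`. -/
theorem exists_measure_exists_closedBall_le {α : Type*} [MetricSpace α]
    [SecondCountableTopology α] [MeasurableSpace α] [OpensMeasurableSpace α]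
    [HasBesicovitchCovering α] :
    ∃ N : ℕ, ∀ (ρ η : Measure α) (ε : ENNReal) (R : ℝ),
      ρ {x | ∃ r, 0 < r ∧ r ≤ R ∧
        ρ (Metric.closedBall x r) ≤ ε * η (Metric.closedBall x r)} ≤ N * (ε * η Set.univ) := by
  obtain ⟨N, τ, hτ, hN⟩ := HasBesicovitchCovering.no_satelliteConfig (α := α)
  refine ⟨N, fun ρ η ε R => ?_⟩
  set A := {x | ∃ r, 0 < r ∧ r ≤ R ∧
    ρ (Metric.closedBall x r) ≤ ε * η (Metric.closedBall x r)}
  choose r hr0 hrR hr using fun x : A => x.2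
  let q : Besicovitch.BallPackage A α := ⟨fun x => x, r, hr0, R, hrR⟩
  obtain ⟨s, hdisj, hcov⟩ := Besicovitch.exist_disjoint_covering_families hτ hN q
  have hcount : ∀ i, (s i).Countable := fun i =>
    (hdisj i).countable_of_nonempty_interior fun x _ =>
      ⟨x, Metric.ball_subset_interior_closedBall (Metric.mem_ball_self (hr0 x))⟩
  have hsub : A ⊆ ⋃ i, ⋃ x ∈ s i, Metric.closedBall (x : α) (r x) := by
    intro x hx
    have := hcov ⟨⟨x, hx⟩, rfl⟩
    simp only [Set.mem_iUnion] at this ⊢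
    obtain ⟨i, y, hy, hxy⟩ := this
    exact ⟨i, y, hy, Metric.ball_subset_closedBall hxy⟩
  calc ρ A ≤ ∑ i : Fin N, ρ (⋃ x ∈ s i, Metric.closedBall (x : α) (r x)) :=
        (measure_mono hsub).trans (measure_iUnion_fintype_le _ _)
    _ ≤ ∑ _i : Fin N, ε * η Set.univ := by
        refine Finset.sum_le_sum fun i _ => ?_
        calc ρ (⋃ x ∈ s i, Metric.closedBall (x : α) (r x))
            ≤ ∑' x : s i, ρ (Metric.closedBall (x : α) (r x)) := measure_biUnion_le _ (hcount i) _
          _ ≤ ∑' x : s i, ε * η (Metric.closedBall (x : α) (r x)) :=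
              ENNReal.tsum_le_tsum fun x => hr x
          _ = ε * η (⋃ x ∈ s i, Metric.closedBall (x : α) (r x)) := by
              rw [ENNReal.tsum_mul_left, measure_biUnion (hcount i) (hdisj i) fun x _ =>
                Metric.isClosed_closedBall.measurableSet]
          _ ≤ ε * η Set.univ := by gcongr; exact Set.subset_univ _
    _ = N * (ε * η Set.univ) := by simp

theorem measurable_measure_closedBall {α : Type*} [PseudoMetricSpace α]
    [SecondCountableTopology α] [MeasurableSpace α] [OpensMeasurableSpace α] (μ : Measure α)
    [SFinite μ] (r : ℝ) : Measurable fun x => μ (Metric.closedBall x r) :=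
  measurable_measure_prodMk_left (s := {z : α × α | dist z.2 z.1 ≤ r})
    (measurableSet_le (measurable_snd.dist measurable_fst) measurable_const)

theorem ae_forall_measure_closedBall_pos {α : Type*} [PseudoMetricSpace α]
    [SecondCountableTopology α] [MeasurableSpace α] (μ : Measure α) :
    ∀ᵐ x ∂μ, ∀ r, 0 < r → 0 < μ (Metric.closedBall x r) := by
  filter_upwards [Measure.support_mem_ae (μ := μ)] with x hx r hr
  exact (Measure.mem_support_iff_forall x).1 hx _ (Metric.closedBall_mem_nhds x hr)

/-- A finite measure on the plane has local dimension at most `2` almost everywhere, by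
differentiation of Lebesgue measure with respect to it. -/
theorem ae_exists_mul_sq_le_measureReal_closedBall (η : Measure ℂ) [IsFiniteMeasure η] :
    ∀ᵐ x ∂η, ∃ C > 0, ∀ᶠ r in 𝓝[>] (0 : ℝ), C * r ^ 2 ≤ η.real (Metric.closedBall x r) := by
  filter_upwards [Besicovitch.ae_tendsto_rnDeriv volume η,
    Measure.rnDeriv_lt_top volume η] with x hx htop
  obtain ⟨K, hK0, hK⟩ := ENNReal.lt_iff_exists_nnreal_btwn.1 htop
  have hKpos : (0 : ℝ) < K := by
    have : (0 : ENNReal) < K := lt_of_le_of_lt zero_le hK0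
    exact_mod_cast this
  refine ⟨Real.pi / K, div_pos Real.pi_pos hKpos, ?_⟩
  filter_upwards [hx.eventually_lt_const hK0, self_mem_nhdsWithin] with r hr hr0
  have hle : volume (Metric.closedBall x r) ≤ K * η (Metric.closedBall x r) :=
    by
    refine (ENNReal.div_le_iff_le_mul (Or.inr ENNReal.coe_ne_top) (Or.inl ?_)).1 hr.le
    exact measure_ne_top _ _
  have := ENNReal.toReal_mono (by finiteness) hle
  rw [Complex.volume_closedBall] at this
  simp only [ENNReal.toReal_mul, ENNReal.toReal_pow, ENNReal.coe_toReal,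
    ENNReal.toReal_ofReal (le_of_lt hr0), NNReal.coe_real_pi] at this
  rw [div_mul_eq_mul_div, div_le_iff₀ hKpos, mul_comm _ (K : ℝ), mul_comm Real.pi]
  exact this

/-- Passage from the scales `s n` to all scales, when `log (s n) ∼ -χ n`. -/
theorem tendsto_log_div_log_of_seq {φ : ℝ → ℝ} (hmono : Monotone φ) (hφ : ∀ r, 0 < r → 0 < φ r)
    (hφ1 : ∀ r, φ r ≤ 1) {s : ℕ → ℝ} (hs : Antitone s) (hs0 : ∀ n, 0 < s n)
    (hslim : Tendsto s atTop (𝓝 0)) {a b : ℝ} (hb : b ≠ 0)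
    (hlogs : Tendsto (fun n : ℕ => Real.log (s n) / n) atTop (𝓝 b))
    (hlogφ : Tendsto (fun n : ℕ => Real.log (φ (s n)) / n) atTop (𝓝 a)) :
    Tendsto (fun r => Real.log (φ r) / Real.log r) (𝓝[>] 0) (𝓝 (a / b)) := by
  classical
  -- `N r` is such that `s (N r + 1) < r ≤ s (N r)` for small `r`
  have hex : ∀ r : ℝ, 0 < r → ∃ n, s (n + 1) < r := fun r hr =>
    (((tendsto_add_atTop_iff_nat 1).2 hslim).eventually_lt_const hr).exists
  let N : ℝ → ℕ := fun r => if hr : 0 < r then Nat.find (hex r hr) else 0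
  have hNlt : ∀ r, 0 < r → s (N r + 1) < r := fun r hr => by
    simp only [N, dif_pos hr]; exact Nat.find_spec (hex r hr)
  have hNge : ∀ n r, 0 < r → r < s n → n ≤ N r := fun n r hr hrn => by
    by_contra! h
    exact absurd ((hs h).trans_lt (hNlt r hr)) (not_lt.2 hrn.le)
  have hNlim : Tendsto N (𝓝[>] 0) atTop := tendsto_atTop.2 fun n => by
    filter_upwards [self_mem_nhdsWithin, mem_nhdsWithin_of_mem_nhds (Iio_mem_nhds (hs0 n))]
      with r hr hrn using hNge n r hr hrn
  have hNle : ∀ r, 0 < r → r < s 1 → r ≤ s (N r) := fun r hr hr1 => by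
    have h1 := hNge 1 r hr hr1
    have hf : N r = Nat.find (hex r hr) := by simp only [N, dif_pos hr]
    have := Nat.find_min (hex r hr) (m := N r - 1) (by omega)
    rwa [Nat.sub_add_cancel h1, not_lt] at this
  have hshift : ∀ {f : ℕ → ℝ} {c : ℝ}, Tendsto (fun n : ℕ => f n / n) atTop (𝓝 c) →
      Tendsto (fun n : ℕ => f (n + 1) / n) atTop (𝓝 c) := by
    intro f c hf
    have h1 := (tendsto_add_atTop_iff_nat 1).2 hf
    have h2 : Tendsto (fun n : ℕ => ((n + 1 : ℕ) : ℝ) / n) atTop (𝓝 (1 + 0)) := by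
      refine (tendsto_one_div_atTop_nhds_zero_nat.const_add 1).congr' ?_
      filter_upwards [eventually_gt_atTop 0] with n hn
      have : (n : ℝ) ≠ 0 := by exact_mod_cast hn.ne'
      push_cast; field_simp
    have h3 := h1.mul h2
    rw [add_zero, mul_one] at h3
    refine h3.congr fun n => ?_
    rw [div_mul_div_cancel₀ (by positivity)]
  have hlow : Tendsto (fun n => Real.log (φ (s n)) / Real.log (s (n + 1))) atTop (𝓝 (a / b)) := by
    refine (hlogφ.div (hshift hlogs) hb).congr' ?_
    filter_upwards [eventually_gt_atTop 0] with n hn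
    exact div_div_div_cancel_right₀ (by exact_mod_cast hn.ne') _ _
  have hupp : Tendsto (fun n => Real.log (φ (s (n + 1))) / Real.log (s n)) atTop (𝓝 (a / b)) := by
    refine ((hshift (f := fun n => Real.log (φ (s n))) hlogφ).div hlogs hb).congr' ?_
    filter_upwards [eventually_gt_atTop 0] with n hn
    exact div_div_div_cancel_right₀ (by exact_mod_cast hn.ne') _ _
  have hs1 : ∀ᶠ n in atTop, s n < 1 := hslim.eventually_lt_const one_pos
  have hsmall : ∀ᶠ r in 𝓝[>] (0 : ℝ), 0 < r ∧ r < s 1 ∧ s (N r) < 1 := by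
    filter_upwards [self_mem_nhdsWithin, mem_nhdsWithin_of_mem_nhds (Iio_mem_nhds (hs0 1)),
      hNlim.eventually hs1] with r h1 h2 h3 using ⟨h1, h2, h3⟩
  have key : ∀ r, 0 < r → r < s 1 → s (N r) < 1 →
      Real.log (φ (s (N r))) / Real.log (s (N r + 1)) ≤ Real.log (φ r) / Real.log r ∧
      Real.log (φ r) / Real.log r ≤ Real.log (φ (s (N r + 1))) / Real.log (s (N r)) := by
    intro r h0 h1 h2
    have hle := hNle r h0 h1
    have hlt := hNlt r h0
    have l1 : Real.log (s (N r)) < 0 := Real.log_neg (hs0 _) h2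
    have l2 : Real.log r ≤ Real.log (s (N r)) := Real.log_le_log h0 hle
    have l3 : Real.log (s (N r + 1)) ≤ Real.log r := Real.log_le_log (hs0 _) hlt.le
    have m1 : Real.log (φ r) ≤ Real.log (φ (s (N r))) := Real.log_le_log (hφ r h0) (hmono hle)
    have m2 : Real.log (φ (s (N r + 1))) ≤ Real.log (φ r) :=
      Real.log_le_log (hφ _ (hs0 _)) (hmono hlt.le)
    have m3 : Real.log (φ (s (N r))) ≤ 0 := Real.log_nonpos (hφ _ (hs0 _)).le (hφ1 _)
    constructor
    · rw [← neg_div_neg_eq, ← neg_div_neg_eq (Real.log (φ r))]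
      exact div_le_div₀ (by linarith) (by linarith) (by linarith) (by linarith)
    · rw [← neg_div_neg_eq, ← neg_div_neg_eq (Real.log (φ (s (N r + 1))))]
      exact div_le_div₀ (by linarith) (by linarith) (by linarith) (by linarith)
  refine tendsto_of_tendsto_of_tendsto_of_le_of_le' (hlow.comp hNlim) (hupp.comp hNlim) ?_ ?_
  · filter_upwards [hsmall] with r ⟨h1, h2, h3⟩ using (key r h1 h2 h3).1
  · filter_upwards [hsmall] with r ⟨h1, h2, h3⟩ using (key r h1 h2 h3).2

/-- An exact dimension of a probability measure on the plane lies in `[0, 2]`. -/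
theorem HasExactDimension.mem_Icc {η : Measure ℂ} [IsProbabilityMeasure η] {α : ℝ}
    (h : HasExactDimension η α) : α ∈ Set.Icc (0 : ℝ) 2 := by
  obtain ⟨x, hx, C, hC, hCr⟩ := (h.and (ae_exists_mul_sq_le_measureReal_closedBall η)).exists
  have hsmall : ∀ᶠ r in 𝓝[>] (0 : ℝ), 0 < r ∧ r < 1 := by
    filter_upwards [self_mem_nhdsWithin, mem_nhdsWithin_of_mem_nhds (Iio_mem_nhds one_pos)]
      with r h1 h2 using ⟨h1, h2⟩
  have hlog : Tendsto (fun r => Real.log C / Real.log r + 2) (𝓝[>] 0) (𝓝 (0 + 2)) :=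
    (Real.tendsto_log_nhdsGT_zero.const_div_atBot _).add_const 2
  constructor
  · refine ge_of_tendsto hx ?_
    filter_upwards [hsmall] with r ⟨h0, h1⟩
    exact div_nonneg_of_nonpos (Real.log_nonpos measureReal_nonneg measureReal_le_one)
      (Real.log_neg h0 h1).le
  · rw [zero_add] at hlog
    refine le_of_tendsto_of_tendsto hx hlog ?_
    filter_upwards [hsmall, hCr] with r ⟨h0, h1⟩ h2
    have hl := Real.log_neg h0 h1
    have h3 : Real.log C + 2 * Real.log r ≤ Real.log (η.real (Metric.closedBall x r)) := by
      have := Real.log_le_log (by positivity) h2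
      rwa [Real.log_mul hC.ne' (by positivity), Real.log_pow] at this
    rw [div_add' _ _ _ hl.ne]
    exact div_le_div_of_nonpos_of_le hl.le (by simpa using h3)

end Balls

/-! ### Random words on a common probability space -/

namespace PlanarModel

variable {I : Type*} [MeasurableSpace I] (S : PlanarModel I)

/-- A simultaneous choice of one letter for each system of the model. Choosing such a family
independently at each time gives words `u ∈ 𝕏_∞^{(ω)}` for all `ω` on one probability space, which
makes the joint measurability in `ω` and `u` evident. -/
abbrev Letters : Type _ := (i : I) → Fin (S.k i)

/-- The law of a random family of letters with independent components. -/
def letterMeasure : Measure S.Letters := Measure.infinitePi S.probMeasure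

instance : IsProbabilityMeasure S.letterMeasure := by unfold letterMeasure; infer_instance

/-- The law of an independent sequence of families of letters. -/
def choiceMeasure : Measure (ℕ → S.Letters) := Measure.infinitePi fun _ => S.letterMeasure

instance : IsProbabilityMeasure S.choiceMeasure := by unfold choiceMeasure; infer_instance

/-- The word in `𝕏_∞^{(ω)}` read off from a sequence of families of letters. -/
def word (ω : ℕ → I) (v : ℕ → S.Letters) : S.Words ω := fun n => v n (ω n)

theorem measurable_word (ω : ℕ → I) : Measurable (S.word ω) :=
  measurable_pi_iff.2 fun n => (measurable_pi_apply (ω n)).comp (measurable_pi_apply n)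

theorem map_word (ω : ℕ → I) : S.choiceMeasure.map (S.word ω) = S.wordMeasure ω := by
  have h := Measure.infinitePi_map_pi (fun _ : ℕ => S.letterMeasure)
    (f := fun n (w : S.Letters) => w (ω n)) fun n => measurable_pi_apply (ω n)
  refine h.trans ?_
  unfold wordMeasure
  congr 1
  funext n
  exact Measure.infinitePi_map_eval S.probMeasure (ω n)

/-- The space of pairs of a selection sequence and a sequence of families of letters. -/
abbrev Pairs : Type _ := (ℕ → I) × (ℕ → S.Letters)

/-- The product `(ω, v) ↦ (Tω, σv)` of the left shifts. -/
def pairShift : S.Pairs → S.Pairs := Prod.map (leftShift I) (leftShift S.Letters)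

/-- The product on `Pairs` of the selection measure and the law of the letters. -/
def pairMeasure : Measure S.Pairs := S.selection.prod S.choiceMeasure

instance : IsProbabilityMeasure S.selection := S.isProbabilityMeasure_selection

instance : IsProbabilityMeasure S.pairMeasure := by unfold pairMeasure; infer_instance

theorem ergodic_pairShift (hS : Ergodic (leftShift I) S.selection) :
    Ergodic S.pairShift S.pairMeasure :=
  hS.prodMap_leftShift S.letterMeasure

/-- The first letter of the word coded by a pair. -/
def firstLetter (z : S.Pairs) : Fin (S.k (z.1 0)) := z.2 0 (z.1 0)

/-- The point of the plane coded by a pair. -/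
def point (z : S.Pairs) : ℂ := S.coding z.1 (S.word z.1 z.2)

theorem randomMeasure_eq_map [Finite I] (ω : ℕ → I) :
    S.randomMeasure ω = S.choiceMeasure.map fun v => S.point (ω, v) := by
  rw [randomMeasure, ← S.map_word ω, Measure.map_map (S.measurable_coding ω) (S.measurable_word ω)]
  rfl

theorem point_eq [Finite I] (z : S.Pairs) :
    S.point z = S.lam (z.1 0) * S.point (S.pairShift z) + S.t (z.1 0) (S.firstLetter z) := by
  have h := (S.summable_coding z.1 (S.word z.1 z.2)).tsum_eq_zero_add
  rw [point, coding, h, Finset.prod_range_zero, one_mul, add_comm, point, coding, ← tsum_mul_left]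
  congr 1
  refine tsum_congr fun n => ?_
  rw [Finset.prod_range_succ', mul_comm _ (S.lam (z.1 0)), mul_assoc]
  rfl

theorem exists_norm_point_le [Finite I] : ∃ R : ℝ, 0 < R ∧ ∀ z : S.Pairs, ‖S.point z‖ ≤ R := by
  obtain ⟨C, ρ, h0, h1, h⟩ := S.exists_summable_bound
  refine ⟨max 1 (∑' n, C * ρ ^ n), by positivity, fun z => le_max_of_le_right ?_⟩
  exact tsum_of_norm_bounded ((summable_geometric_of_lt_one h0 h1).mul_left C).hasSum
    (h z.1 (S.word z.1 z.2))

section Measurability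

variable [Finite I] [MeasurableSingletonClass I]

theorem measurable_apply_firstLetter {β : Type*} [MeasurableSpace β]
    (g : (i : I) → Fin (S.k i) → β) (n : ℕ) :
    Measurable fun z : S.Pairs => g (z.1 n) (z.2 n (z.1 n)) := by
  have hg : Measurable fun q : I × S.Letters => g q.1 (q.2 q.1) := measurable_of_countable _
  have h : Measurable fun z : S.Pairs => (z.1 n, z.2 n) := by fun_prop
  exact hg.comp h

theorem measurable_apply_selection {β : Type*} [MeasurableSpace β] (g : I → β) (n : ℕ) :
    Measurable fun ω : ℕ → I => g (ω n) :=
  (measurable_of_countable g).comp (measurable_pi_apply n)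

theorem measurable_point : Measurable S.point := by
  refine measurable_of_tendsto_metrizable
    (f := fun n (z : S.Pairs) => S.comp z.1 (S.word z.1 z.2) n 0) (fun n => ?_)
    (tendsto_pi_nhds.2 fun z => S.tendsto_comp z.1 (S.word z.1 z.2))
  simp only [comp_apply]
  have hprod : ∀ m : ℕ, Measurable fun z : S.Pairs =>
      ∏ j ∈ Finset.range m, S.lam (z.1 j) := fun m =>
    Finset.measurable_fun_prod _ fun j _ =>
      (measurable_apply_selection S.lam j).comp measurable_fst
  exact ((hprod n).mul_const 0).add (Finset.measurable_fun_sum _ fun m _ =>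
    (hprod m).mul (S.measurable_apply_firstLetter S.t m))

end Measurability

/-! ### Masses at the scales of the model -/

/-- The scale `R |λ_{ω_0} ⋯ λ_{ω_{n-1}}|`. -/
def scale (R : ℝ) (n : ℕ) (ω : ℕ → I) : ℝ := R * ∏ j ∈ Finset.range n, ‖S.lam (ω j)‖

theorem scale_pos {R : ℝ} (hR : 0 < R) (n : ℕ) (ω : ℕ → I) : 0 < S.scale R n ω :=
  mul_pos hR (Finset.prod_pos fun _ _ => norm_pos_iff.2 (S.lam_ne_zero _))

theorem scale_succ (R : ℝ) (n : ℕ) (ω : ℕ → I) :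
    S.scale R (n + 1) ω = ‖S.lam (ω 0)‖ * S.scale R n (leftShift I ω) := by
  rw [scale, scale, Finset.prod_range_succ']
  simp only [leftShift]
  ring

theorem antitone_scale {R : ℝ} (hR : 0 < R) (ω : ℕ → I) : Antitone fun n => S.scale R n ω := by
  refine antitone_nat_of_succ_le fun n => ?_
  rw [scale, Finset.prod_range_succ, ← mul_assoc]
  exact mul_le_of_le_one_right (S.scale_pos hR n ω).le (S.norm_lam_lt_one _).le

theorem tendsto_scale [Finite I] (R : ℝ) (ω : ℕ → I) :
    Tendsto (fun n => S.scale R n ω) atTop (𝓝 0) := by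
  have : Nonempty I := ⟨ω 0⟩
  obtain ⟨i₀, hi₀⟩ := Finite.exists_max fun i => ‖S.lam i‖
  have h : Tendsto (fun n => ∏ j ∈ Finset.range n, ‖S.lam (ω j)‖) atTop (𝓝 0) := by
    refine squeeze_zero (fun n => by positivity) (fun n => ?_)
      (tendsto_pow_atTop_nhds_zero_of_lt_one (norm_nonneg _) (S.norm_lam_lt_one i₀))
    calc _ ≤ ∏ _j ∈ Finset.range n, ‖S.lam i₀‖ :=
          Finset.prod_le_prod (fun _ _ => norm_nonneg _) fun _ _ => hi₀ _
      _ = _ := by simp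
  simpa [scale] using h.const_mul R

theorem log_scale {R : ℝ} (hR : 0 < R) (n : ℕ) (ω : ℕ → I) :
    Real.log (S.scale R n ω) = Real.log R +
      birkhoffSum (leftShift I) (fun ω => Real.log ‖S.lam (ω 0)‖) n ω := by
  have h : ∀ i, ‖S.lam i‖ ≠ 0 := fun i => norm_ne_zero_iff.2 (S.lam_ne_zero i)
  rw [scale, Real.log_mul hR.ne' (Finset.prod_ne_zero_iff.2 fun _ _ => h _),
    Real.log_prod fun _ _ => h _]
  simp [birkhoffSum, leftShift_iterate_apply]

theorem measurable_scale [Finite I] [MeasurableSingletonClass I] (R : ℝ) (n : ℕ) :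
    Measurable (S.scale R n) :=
  (Finset.measurable_fun_prod _ fun j _ =>
    measurable_apply_selection (fun i => ‖S.lam i‖) j).const_mul R

/-- The part of `η^{(ω)}` carried by the words with first letter `j`. -/
def letterPart (ω : ℕ → I) (j : Fin (S.k (ω 0))) : Measure ℂ :=
  (S.choiceMeasure.restrict {v | S.firstLetter (ω, v) = j}).map fun v => S.point (ω, v)

/-- The mass `η^{(ω)}(B(x, r))` for `x` the point coded by `(ω, v)` and `r` the `n`-th scale. -/
def ballMass (R : ℝ) (n : ℕ) (z : S.Pairs) : ENNReal :=
  S.randomMeasure z.1 (Metric.closedBall (S.point z) (S.scale R n z.1))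

/-- The contribution to `ballMass` of the words with the same first letter as `(ω, v)`. -/
def letterBallMass (R : ℝ) (n : ℕ) (z : S.Pairs) : ENNReal :=
  S.letterPart z.1 (S.firstLetter z) (Metric.closedBall (S.point z) (S.scale R n z.1))

section Masses

instance (ω : ℕ → I) (j : Fin (S.k (ω 0))) : IsFiniteMeasure (S.letterPart ω j) := by
  unfold letterPart; infer_instance

theorem letterBallMass_ne_top (R : ℝ) (n : ℕ) (z : S.Pairs) : S.letterBallMass R n z ≠ ⊤ :=
  measure_ne_top _ _

theorem measurableSet_firstLetter_eq (ω : ℕ → I) (j : Fin (S.k (ω 0))) :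
    MeasurableSet {v | S.firstLetter (ω, v) = j} := by
  have h : Measurable fun v : ℕ → S.Letters => v 0 (ω 0) := by fun_prop
  exact h (measurableSet_singleton j)

variable [Finite I]

theorem ballMass_ne_top (R : ℝ) (n : ℕ) (z : S.Pairs) : S.ballMass R n z ≠ ⊤ :=
  measure_ne_top _ _

variable [MeasurableSingletonClass I]

theorem measurable_point_mk (ω : ℕ → I) : Measurable fun v => S.point (ω, v) :=
  S.measurable_point.comp measurable_prodMk_left

theorem letterPart_le (ω : ℕ → I) (j : Fin (S.k (ω 0))) :
    S.letterPart ω j ≤ S.randomMeasure ω := by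
  rw [randomMeasure_eq_map]
  exact Measure.map_mono Measure.restrict_le_self (S.measurable_point_mk ω)

theorem ballMass_eq (R : ℝ) (n : ℕ) (z : S.Pairs) : S.ballMass R n z =
    S.choiceMeasure {v | dist (S.point (z.1, v)) (S.point z) ≤ S.scale R n z.1} := by
  rw [ballMass, randomMeasure_eq_map, Measure.map_apply (S.measurable_point_mk z.1)
    Metric.isClosed_closedBall.measurableSet]
  rfl

theorem letterBallMass_eq (R : ℝ) (n : ℕ) (z : S.Pairs) : S.letterBallMass R n z =
    S.choiceMeasure {v | S.firstLetter (z.1, v) = S.firstLetter z ∧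
      dist (S.point (z.1, v)) (S.point z) ≤ S.scale R n z.1} := by
  have hm := S.measurable_point_mk z.1 (Metric.isClosed_closedBall (x := S.point z)
    (ε := S.scale R n z.1)).measurableSet
  rw [letterBallMass, letterPart, Measure.map_apply (S.measurable_point_mk z.1)
    Metric.isClosed_closedBall.measurableSet, Measure.restrict_apply hm, Set.inter_comm]
  rfl

theorem measurableSet_dist_le_scale (R : ℝ) (n : ℕ) :
    MeasurableSet {q : S.Pairs × (ℕ → S.Letters) |
      dist (S.point (q.1.1, q.2)) (S.point q.1) ≤ S.scale R n q.1.1} := by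
  refine measurableSet_le (Measurable.dist ?_ (S.measurable_point.comp measurable_fst))
    ((S.measurable_scale R n).comp (measurable_fst.comp measurable_fst))
  exact S.measurable_point.comp ((measurable_fst.comp measurable_fst).prodMk measurable_snd)

theorem measurable_ballMass (R : ℝ) (n : ℕ) : Measurable (S.ballMass R n) := by
  rw [funext (S.ballMass_eq R n)]
  exact measurable_measure_prodMk_left (S.measurableSet_dist_le_scale R n)

theorem measurable_letterBallMass (R : ℝ) (n : ℕ) : Measurable (S.letterBallMass R n) := by
  rw [funext (S.letterBallMass_eq R n)]
  refine measurable_measure_prodMk_left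
    (s := {q : S.Pairs × (ℕ → S.Letters) | S.firstLetter (q.1.1, q.2) = S.firstLetter q.1 ∧
      dist (S.point (q.1.1, q.2)) (S.point q.1) ≤ S.scale R n q.1.1})
    (MeasurableSet.inter ?_ (S.measurableSet_dist_le_scale R n))
  have h : Measurable fun q : I × S.Letters × S.Letters => (q.2.1 q.1 = q.2.2 q.1 : Prop) :=
    measurable_of_countable _
  have h' : Measurable fun q : S.Pairs × (ℕ → S.Letters) => (q.1.1 0, q.2 0, q.1.2 0) := by
    fun_prop
  exact measurableSet_setOfPred.2 (h.comp h')

theorem letterBallMass_le_ballMass (R : ℝ) (n : ℕ) (z : S.Pairs) :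
    S.letterBallMass R n z ≤ S.ballMass R n z :=
  S.letterPart_le _ _ _

theorem ballMass_zero {R : ℝ} (hR : ∀ z : S.Pairs, ‖S.point z‖ ≤ R) (z : S.Pairs) :
    S.ballMass (2 * R) 0 z = 1 := by
  rw [ballMass_eq]
  convert measure_univ (μ := S.choiceMeasure)
  refine Set.eq_univ_of_forall fun v => ?_
  have := dist_le_norm_add_norm (S.point (z.1, v)) (S.point z)
  simp only [Set.mem_ofPred_eq, scale, Finset.prod_range_zero, mul_one]
  linarith [hR (z.1, v), hR z]

/-- The self-similarity relation: a word with first letter `j` codes a point within `|λ_{ω_0}| r` of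
`x` if and only if the shifted word codes a point within `r` of `f_j⁻¹ x`. -/
theorem letterBallMass_succ (R : ℝ) (n : ℕ) (z : S.Pairs) :
    S.letterBallMass R (n + 1) z =
      ENNReal.ofReal (S.p (z.1 0) (S.firstLetter z)) * S.ballMass R n (S.pairShift z) := by
  rw [letterBallMass_eq, ballMass_eq]
  have hB : MeasurableSet {w | dist (S.point ((S.pairShift z).1, w)) (S.point (S.pairShift z)) ≤
      S.scale R n (S.pairShift z).1} :=
    measurable_prodMk_left (x := S.pairShift z) (S.measurableSet_dist_le_scale R n)
  have ha : MeasurableSet {w : S.Letters | w (z.1 0) = S.firstLetter z} := by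
    have h : Measurable fun w : S.Letters => w (z.1 0) := by fun_prop
    exact h (measurableSet_singleton (S.firstLetter z))
  have h := infinitePi_eval_zero_inter_leftShift S.letterMeasure ha hB
  have hp : S.letterMeasure {w : S.Letters | w (z.1 0) = S.firstLetter z} =
      ENNReal.ofReal (S.p (z.1 0) (S.firstLetter z)) := by
    have := (measurePreserving_eval_infinitePi S.probMeasure (z.1 0)).measure_preimage
      (measurableSet_singleton (S.firstLetter z)).nullMeasurableSet
    refine this.trans ?_
    simp [probMeasure, Set.indicator_apply, Finset.sum_ite_eq']
  rw [hp] at h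
  refine Eq.trans (congrArg _ ?_) h
  ext v
  refine and_congr_right fun hv => ?_
  rw [S.point_eq (z.1, v), S.point_eq z, hv, dist_add_right, dist_eq_norm, ← mul_sub, norm_mul,
    scale_succ]
  have hlam : 0 < ‖S.lam (z.1 0)‖ := norm_pos_iff.2 (S.lam_ne_zero _)
  rw [mul_le_mul_iff_right₀ hlam, ← dist_eq_norm]
  rfl

/-- What holds `letterPart ω j`-almost everywhere for each letter `j` holds for almost every pair
with `j` its first letter. -/
theorem ae_of_ae_letterPart {q : (ω : ℕ → I) → Fin (S.k (ω 0)) → ℂ → Prop} (ω : ℕ → I)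
    (h : ∀ j, ∀ᵐ x ∂S.letterPart ω j, q ω j x) :
    ∀ᵐ v ∂S.choiceMeasure, q ω (S.firstLetter (ω, v)) (S.point (ω, v)) := by
  have h' : ∀ j, ∀ᵐ v ∂S.choiceMeasure, S.firstLetter (ω, v) = j → q ω j (S.point (ω, v)) :=
    fun j => (ae_restrict_iff' (S.measurableSet_firstLetter_eq ω j)).1
      (ae_of_ae_map (S.measurable_point_mk ω).aemeasurable (h j))
  filter_upwards [ae_all_iff.2 h'] with v hv using hv _ rfl

theorem ae_letterBallMass_pos {R : ℝ} (hR : 0 < R) :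
    ∀ᵐ z ∂S.pairMeasure, ∀ n, 0 < S.letterBallMass R n z := by
  refine ae_all_iff.2 fun n => ?_
  refine (Measure.ae_prod_iff_ae_ae (measurableSet_lt measurable_const
    (S.measurable_letterBallMass R n))).2 (Eventually.of_forall fun ω => ?_)
  refine S.ae_of_ae_letterPart
    (q := fun ω j x => 0 < S.letterPart ω j (Metric.closedBall x (S.scale R n ω))) ω fun j => ?_
  filter_upwards [ae_forall_measure_closedBall_pos (S.letterPart ω j)] with x hx
    using hx _ (S.scale_pos hR n ω)

/-- Differentiation of measures: the conditional mass of the first letter of `(ω, v)` in small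
balls has a limit. -/
theorem ae_exists_tendsto_letterBallMass_div {R : ℝ} (hR : 0 < R) :
    ∀ ω, ∀ᵐ v ∂S.choiceMeasure, ∃ l : ENNReal,
      Tendsto (fun n => S.letterBallMass R n (ω, v) / S.ballMass R n (ω, v)) atTop (𝓝 l) := by
  intro ω
  have hs : Tendsto (fun n => S.scale R n ω) atTop (𝓝[>] 0) :=
    tendsto_nhdsWithin_iff.2 ⟨S.tendsto_scale R ω, Eventually.of_forall fun n => S.scale_pos hR n ω⟩
  refine S.ae_of_ae_letterPart (q := fun ω j x => ∃ l : ENNReal, Tendsto (fun n =>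
    S.letterPart ω j (Metric.closedBall x (S.scale R n ω)) /
      S.randomMeasure ω (Metric.closedBall x (S.scale R n ω))) atTop (𝓝 l)) ω fun j => ?_
  have h := Besicovitch.ae_tendsto_rnDeriv (S.letterPart ω j) (S.randomMeasure ω)
  filter_upwards [(S.letterPart_le ω j).absolutelyContinuous.ae_le h] with x hx
  exact ⟨_, hx.comp hs⟩

/-- The maximal inequality for the conditional mass of the first letter, uniformly in `ω`. -/
theorem exists_pairMeasure_letterBallMass_le : ∃ C : ENNReal, C ≠ ⊤ ∧
    ∀ (R : ℝ), 0 < R → ∀ ε : ENNReal, S.pairMeasure {z | ∃ n, S.letterBallMass R n z ≤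
      ε * S.ballMass R n z} ≤ C * ε := by
  obtain ⟨N, hN⟩ := exists_measure_exists_closedBall_le (α := ℂ)
  obtain ⟨K, hK⟩ := (Set.finite_range S.k).bddAbove
  refine ⟨K * N, by finiteness, fun R hR ε => ?_⟩
  have hmeas : MeasurableSet {z | ∃ n, S.letterBallMass R n z ≤ ε * S.ballMass R n z} := by
    rw [Set.ofPred_exists]
    exact MeasurableSet.iUnion fun n => measurableSet_le (S.measurable_letterBallMass R n)
      ((S.measurable_ballMass R n).const_mul ε)
  rw [pairMeasure, Measure.prod_apply hmeas]
  have hbound : ∀ ω, S.choiceMeasure (Prod.mk ω ⁻¹'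
      {z | ∃ n, S.letterBallMass R n z ≤ ε * S.ballMass R n z}) ≤ K * N * ε := by
    intro ω
    let A : Fin (S.k (ω 0)) → Set ℂ := fun j => {x | ∃ r, 0 < r ∧ r ≤ R ∧
      S.letterPart ω j (Metric.closedBall x r) ≤ ε * S.randomMeasure ω (Metric.closedBall x r)}
    have hsub : Prod.mk ω ⁻¹' {z | ∃ n, S.letterBallMass R n z ≤ ε * S.ballMass R n z} ⊆
        ⋃ j, ((fun v => S.point (ω, v)) ⁻¹' A j ∩ {v | S.firstLetter (ω, v) = j}) := by
      rintro v ⟨n, hn⟩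
      refine Set.mem_iUnion.2 ⟨S.firstLetter (ω, v), ⟨S.scale R n ω, S.scale_pos hR n ω, ?_, hn⟩,
        rfl⟩
      exact (S.antitone_scale hR ω (Nat.zero_le n)).trans (by simp [scale])
    refine (measure_mono hsub).trans ((measure_iUnion_fintype_le _ _).trans ?_)
    calc _ ≤ ∑ j, S.letterPart ω j (A j) := Finset.sum_le_sum fun j _ =>
          (Measure.le_restrict_apply _ _).trans
            (Measure.le_map_apply (S.measurable_point_mk ω).aemeasurable _)
      _ ≤ ∑ _j : Fin (S.k (ω 0)), N * ε := Finset.sum_le_sum fun j _ => by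
          simpa using hN (S.letterPart ω j) (S.randomMeasure ω) ε R
      _ = S.k (ω 0) * (N * ε) := by simp
      _ ≤ K * N * ε := by
          rw [mul_assoc]
          have : S.k (ω 0) ≤ K := hK ⟨ω 0, rfl⟩
          gcongr
  calc _ ≤ ∫⁻ _, K * N * ε ∂S.selection := lintegral_mono hbound
    _ = K * N * ε := by simp

end Masses

end PlanarModel

/-! ### Exact dimension -/

namespace PlanarModel

variable {I : Type*} [MeasurableSpace I] (S : PlanarModel I)

/-- The logarithm of the conditional mass of the first letter of `z` in a ball of the `n`-th scale
around the point coded by `z`. -/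
def logRatio (R : ℝ) (n : ℕ) (z : S.Pairs) : ℝ :=
  Real.log ((S.letterBallMass R n z).toReal / (S.ballMass R n z).toReal)

/-- The logarithm of the probability of the first letter. -/
def logProb (z : S.Pairs) : ℝ := Real.log (S.p (z.1 0) (S.firstLetter z))

variable [Finite I]

theorem exists_abs_logProb_le : ∃ B : ℝ, ∀ z : S.Pairs, |S.logProb z| ≤ B := by
  obtain ⟨B, hB⟩ := (Set.finite_range fun x : (Σ i, Fin (S.k i)) =>
    |Real.log (S.p x.1 x.2)|).bddAbove
  exact ⟨B, fun z => hB ⟨⟨z.1 0, S.firstLetter z⟩, rfl⟩⟩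

variable [MeasurableSingletonClass I]

theorem measurable_logRatio (R : ℝ) (n : ℕ) : Measurable (S.logRatio R n) :=
  Real.measurable_log.comp ((S.measurable_letterBallMass R n).ennreal_toReal.div
    (S.measurable_ballMass R n).ennreal_toReal)

theorem measurable_logProb : Measurable S.logProb :=
  S.measurable_apply_firstLetter (fun i j => Real.log (S.p i j)) 0

/-- Iterating the self-similarity relation along the orbit of `z` writes `log η^{(ω)}(B(x, r_n))` as
a sum to which Maker's theorem applies. -/
theorem log_ballMass_eq_sum {R : ℝ} (hR : ∀ z : S.Pairs, ‖S.point z‖ ≤ R) (n : ℕ) (z : S.Pairs)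
    (hz : ∀ k n, 0 < S.letterBallMass (2 * R) n (S.pairShift^[k] z)) :
    Real.log (S.ballMass (2 * R) n z).toReal = ∑ k ∈ Finset.range n,
      (S.logProb (S.pairShift^[k] z) - S.logRatio (2 * R) (n - k) (S.pairShift^[k] z)) := by
  induction n generalizing z with
  | zero => simp [S.ballMass_zero hR]
  | succ n ih =>
    have hpos : ∀ k n, 0 < (S.letterBallMass (2 * R) n (S.pairShift^[k] z)).toReal := fun k n =>
      ENNReal.toReal_pos (hz k n).ne' (S.letterBallMass_ne_top _ _ _)
    have hpos' : ∀ k n, 0 < (S.ballMass (2 * R) n (S.pairShift^[k] z)).toReal := fun k n =>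
      (hpos k n).trans_le (ENNReal.toReal_mono (S.ballMass_ne_top _ _ _)
        (S.letterBallMass_le_ballMass _ _ _))
    rw [Finset.sum_range_succ']
    simp only [Function.iterate_succ_apply, Nat.add_sub_add_right, Function.iterate_zero, id,
      Nat.sub_zero]
    rw [← ih (S.pairShift z) fun k n => hz (k + 1) n]
    have h := congrArg (fun a : ENNReal => Real.log a.toReal)
      (S.letterBallMass_succ (2 * R) n z)
    simp only [ENNReal.toReal_mul, ENNReal.toReal_ofReal (S.p_pos _ _).le] at h
    have h1 : (S.ballMass (2 * R) n (S.pairShift z)).toReal ≠ 0 := (hpos' 1 n).ne'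
    rw [Real.log_mul (S.p_pos _ _).ne' h1] at h
    have h2 : (S.letterBallMass (2 * R) (n + 1) z).toReal ≠ 0 := (hpos 0 (n + 1)).ne'
    have h3 : (S.ballMass (2 * R) (n + 1) z).toReal ≠ 0 := (hpos' 0 (n + 1)).ne'
    rw [logRatio, Real.log_div h2 h3, logProb]
    linarith

/-- The maximal inequality makes `sup_n |log-ratio|` integrable: its tails decay exponentially. -/
theorem exists_integrable_abs_logRatio_le {R : ℝ} (hR : 0 < R) :
    ∃ G : S.Pairs → ℝ, Measurable G ∧ Integrable G S.pairMeasure ∧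
      ∀ᵐ z ∂S.pairMeasure, ∀ n, |S.logRatio R n z| ≤ G z := by
  obtain ⟨C, hC, hmax⟩ := S.exists_pairMeasure_letterBallMass_le
  let E : ℕ → Set S.Pairs := fun s => {z | ∃ n, S.letterBallMass R n z ≤
    ENNReal.ofReal (Real.exp (-1) ^ s) * S.ballMass R n z}
  have hE : ∀ s, MeasurableSet (E s) := fun s => by
    simp only [E, Set.ofPred_exists]
    exact MeasurableSet.iUnion fun n => measurableSet_le (S.measurable_letterBallMass R n)
      ((S.measurable_ballMass R n).const_mul _)
  -- `H` counts the `s` for which the supremum exceeds `s`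
  let H : S.Pairs → ENNReal := fun z => ∑' s, (E s).indicator 1 z
  have hHm : Measurable H := Measurable.tsum fun s => measurable_one.indicator (hE s)
  have hexp : Real.exp (-1) < 1 := by simp
  have hHint : ∫⁻ z, H z ∂S.pairMeasure ≠ ⊤ := by
    rw [lintegral_tsum fun s => (measurable_one.indicator (hE s)).aemeasurable]
    have hle : ∑' s, ∫⁻ z, (E s).indicator 1 z ∂S.pairMeasure ≤
        C * ENNReal.ofReal (∑' s : ℕ, Real.exp (-1) ^ s) := by
      rw [ENNReal.ofReal_tsum_of_nonneg (fun s => by positivity)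
        (summable_geometric_of_lt_one (Real.exp_pos _).le hexp), ← ENNReal.tsum_mul_left]
      refine ENNReal.tsum_le_tsum fun s => ?_
      rw [lintegral_indicator_one (hE s)]
      exact hmax R hR _
    exact ne_top_of_le_ne_top (by finiteness) hle
  refine ⟨fun z => (H z).toReal, hHm.ennreal_toReal,
    integrable_toReal_of_lintegral_ne_top hHm.aemeasurable hHint, ?_⟩
  filter_upwards [S.ae_letterBallMass_pos hR, ae_lt_top hHm hHint] with z hz hfin n
  have hpos : 0 < (S.letterBallMass R n z).toReal :=
    ENNReal.toReal_pos (hz n).ne' (S.letterBallMass_ne_top _ _ _)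
  have hle : (S.letterBallMass R n z).toReal ≤ (S.ballMass R n z).toReal :=
    ENNReal.toReal_mono (S.ballMass_ne_top _ _ _) (S.letterBallMass_le_ballMass _ _ _)
  have hpos' := hpos.trans_le hle
  have hnonpos : S.logRatio R n z ≤ 0 :=
    Real.log_nonpos (by positivity) ((div_le_one hpos').2 hle)
  rw [abs_of_nonpos hnonpos]
  have hmem : ∀ s : ℕ, (s : ℝ) ≤ -S.logRatio R n z → z ∈ E s := by
    intro s hs
    refine ⟨n, ?_⟩
    have h1 : Real.log ((S.letterBallMass R n z).toReal / (S.ballMass R n z).toReal) ≤ -s := by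
      change S.logRatio R n z ≤ -s
      linarith
    rw [Real.log_le_iff_le_exp (by positivity), div_le_iff₀ hpos'] at h1
    have h2 : Real.exp (-1) ^ s = Real.exp (-s) := by rw [← Real.exp_nat_mul]; simp
    rw [h2]
    have h3 := ENNReal.ofReal_le_ofReal h1
    rwa [ENNReal.ofReal_mul (Real.exp_pos _).le, ENNReal.ofReal_toReal (S.letterBallMass_ne_top _ _ _),
      ENNReal.ofReal_toReal (S.ballMass_ne_top _ _ _)] at h3
  set L := -S.logRatio R n z
  have hcount : ((⌊L⌋₊ + 1 : ℕ) : ENNReal) ≤ H z := by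
    calc ((⌊L⌋₊ + 1 : ℕ) : ENNReal)
        = ∑ s ∈ Finset.range (⌊L⌋₊ + 1), (E s).indicator 1 z := by
          rw [Finset.sum_congr rfl fun s hs => Set.indicator_of_mem (hmem s ?_) 1]
          · simp
          · exact (Nat.le_floor_iff (by simpa [L] using hnonpos)).1
              (Nat.lt_succ_iff.1 (Finset.mem_range.1 hs))
      _ ≤ H z := ENNReal.sum_le_tsum _
  have := ENNReal.toReal_mono hfin.ne hcount
  rw [ENNReal.toReal_natCast] at this
  push_cast at this
  exact (Nat.lt_floor_add_one L).le.trans this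

theorem exists_ae_tendsto_logRatio {R : ℝ} (hR : 0 < R) :
    ∃ g : S.Pairs → ℝ, Measurable g ∧
      ∀ᵐ z ∂S.pairMeasure, Tendsto (fun n => S.logRatio R n z) atTop (𝓝 (g z)) := by
  obtain ⟨G, -, -, hG⟩ := S.exists_integrable_abs_logRatio_le hR
  have hratio : ∀ n, Measurable fun z => S.letterBallMass R n z / S.ballMass R n z := fun n =>
    (S.measurable_letterBallMass R n).div (S.measurable_ballMass R n)
  have hex : ∀ᵐ z ∂S.pairMeasure, ∃ l : ENNReal,
      Tendsto (fun n => S.letterBallMass R n z / S.ballMass R n z) atTop (𝓝 l) :=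
    (Measure.ae_prod_iff_ae_ae (measurableSet_exists_tendsto hratio)).2
      (Eventually.of_forall (S.ae_exists_tendsto_letterBallMass_div hR))
  have hex' : ∀ᵐ z ∂S.pairMeasure, ∃ l : ℝ,
      Tendsto (fun n => S.logRatio R n z) atTop (𝓝 l) := by
    filter_upwards [hex, hG, S.ae_letterBallMass_pos hR] with z ⟨l, hl⟩ hGz hz
    have hl1 : l ≤ 1 := le_of_tendsto' hl fun n =>
      ENNReal.div_le_of_le_mul (by simpa using S.letterBallMass_le_ballMass R n z)
    have hreal := (ENNReal.tendsto_toReal (ne_top_of_le_ne_top ENNReal.one_ne_top hl1)).comp hl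
    simp only [Function.comp_def, ENNReal.toReal_div] at hreal
    -- the domination of the logarithms keeps the limit of the ratios away from `0`
    have hlow : Real.exp (-G z) ≤ l.toReal := by
      refine ge_of_tendsto' hreal fun n => ?_
      have hpos : 0 < (S.letterBallMass R n z).toReal :=
        ENNReal.toReal_pos (hz n).ne' (S.letterBallMass_ne_top _ _ _)
      have hpos' : 0 < (S.ballMass R n z).toReal := hpos.trans_le
        (ENNReal.toReal_mono (S.ballMass_ne_top _ _ _) (S.letterBallMass_le_ballMass _ _ _))
      rw [← Real.le_log_iff_exp_le (by positivity)]
      exact (abs_le.1 (hGz n)).1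
    exact ⟨_, hreal.log ((Real.exp_pos _).trans_le hlow).ne'⟩
  exact measurable_limit_of_tendsto_metrizable_ae
    (fun n => (S.measurable_logRatio R n).aemeasurable) hex'

theorem exists_ae_tendsto_log_ballMass_div (hS : Ergodic (leftShift I) S.selection) {R : ℝ}
    (hR0 : 0 < R) (hR : ∀ z : S.Pairs, ‖S.point z‖ ≤ R) :
    ∃ a : ℝ, ∀ᵐ z ∂S.pairMeasure,
      Tendsto (fun n : ℕ => Real.log (S.ballMass (2 * R) n z).toReal / n) atTop (𝓝 a) := by
  have hR2 : 0 < 2 * R := by positivity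
  have herg := S.ergodic_pairShift hS
  obtain ⟨G, hGm, hGint, hG⟩ := S.exists_integrable_abs_logRatio_le hR2
  obtain ⟨g, hgm, hg⟩ := S.exists_ae_tendsto_logRatio hR2
  obtain ⟨B, hB⟩ := S.exists_abs_logProb_le
  have hmaker := herg.ae_tendsto_sum_sub_div (F := fun n z => S.logProb z - S.logRatio (2 * R) n z)
    (F' := fun z => S.logProb z - g z) (G := fun z => B + G z)
    (fun n => S.measurable_logProb.sub (S.measurable_logRatio _ n))
    (S.measurable_logProb.sub hgm) (hGm.const_add B) ((integrable_const B).add hGint)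
    (by
      filter_upwards [hG] with z hz n
      exact (abs_sub _ _).trans (add_le_add (hB z) (hz n)))
    (by filter_upwards [hg] with z hz using hz.const_sub _)
  have hpos : ∀ᵐ z ∂S.pairMeasure, ∀ k n,
      0 < S.letterBallMass (2 * R) n (S.pairShift^[k] z) :=
    ae_all_iff.2 fun k => (herg.toMeasurePreserving.iterate k).quasiMeasurePreserving.ae
      (S.ae_letterBallMass_pos hR2)
  refine ⟨∫ z, S.logProb z - g z ∂S.pairMeasure, ?_⟩
  filter_upwards [hmaker, hpos] with z hz hzpos
  simpa only [S.log_ballMass_eq_sum hR _ z hzpos] using hz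

/-- The scales decay at the exponential rate given by the Lyapunov exponent `∫ log |λ_{ω_0}| dℙ`. -/
theorem exists_ae_tendsto_log_scale_div (hS : Ergodic (leftShift I) S.selection) {R : ℝ}
    (hR : 0 < R) : ∃ b : ℝ, b < 0 ∧ ∀ᵐ ω ∂S.selection,
      Tendsto (fun n : ℕ => Real.log (S.scale R n ω) / n) atTop (𝓝 b) := by
  have : Nonempty I := by
    obtain ⟨ω⟩ := S.selection.nonempty_of_neZero
    exact ⟨ω 0⟩
  have hm : Measurable fun ω : ℕ → I => Real.log ‖S.lam (ω 0)‖ :=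
    measurable_apply_selection (fun i => Real.log ‖S.lam i‖) 0
  obtain ⟨i₀, hi₀⟩ := Finite.exists_max fun i => Real.log ‖S.lam i‖
  obtain ⟨i₁, hi₁⟩ := Finite.exists_max fun i => |Real.log ‖S.lam i‖|
  have hint : Integrable (fun ω : ℕ → I => Real.log ‖S.lam (ω 0)‖) S.selection :=
    Integrable.of_bound hm.aestronglyMeasurable |Real.log ‖S.lam i₁‖|
      (Eventually.of_forall fun ω => hi₁ (ω 0))
  refine ⟨∫ ω, Real.log ‖S.lam (ω 0)‖ ∂S.selection, ?_, ?_⟩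
  · have h1 : ∫ ω, Real.log ‖S.lam (ω 0)‖ ∂S.selection ≤
        ∫ _, Real.log ‖S.lam i₀‖ ∂S.selection :=
      integral_mono hint (integrable_const _) fun ω => hi₀ (ω 0)
    have h2 : Real.log ‖S.lam i₀‖ < 0 :=
      Real.log_neg (norm_pos_iff.2 (S.lam_ne_zero i₀)) (S.norm_lam_lt_one i₀)
    simp only [integral_const, probReal_univ, one_smul] at h1
    linarith
  · filter_upwards [hS.ae_tendsto_birkhoffSum_div hm hint] with ω hω
    have h := (tendsto_const_div_atTop_nhds_zero_nat (Real.log R)).add hω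
    rw [zero_add] at h
    refine h.congr fun n => ?_
    rw [S.log_scale hR, add_div]

end PlanarModel

end

theorem proposition1p2 {I : Type*} [Finite I] [MeasurableSpace I] [MeasurableSingletonClass I]
    (S : PlanarModel I) (hS : Ergodic (leftShift I) S.selection) :
    ∃ α ∈ Set.Icc (0 : ℝ) 2,
      ∀ᵐ ω ∂S.selection, HasExactDimension (S.randomMeasure ω) α := by
  obtain ⟨R, hR0, hR⟩ := S.exists_norm_point_le
  have hR2 : 0 < 2 * R := by positivity
  obtain ⟨a, ha⟩ := S.exists_ae_tendsto_log_ballMass_div hS hR0 hR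
  obtain ⟨b, hb, hbs⟩ := S.exists_ae_tendsto_log_scale_div hS hR2
  have hdim : ∀ᵐ ω ∂S.selection, HasExactDimension (S.randomMeasure ω) (a / b) := by
    filter_upwards [Measure.ae_ae_of_ae_prod ha, hbs] with ω hω hωb
    have hmeas : MeasurableSet {x : ℂ | Tendsto (fun n : ℕ => Real.log (S.randomMeasure ω
        (Metric.closedBall x (S.scale (2 * R) n ω))).toReal / n) atTop (𝓝 a)} :=
      measurableSet_tendsto _ fun n => (Real.measurable_log.comp
        (measurable_measure_closedBall _ _).ennreal_toReal).div_const _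
    have hx : ∀ᵐ x ∂S.randomMeasure ω, Tendsto (fun n : ℕ => Real.log (S.randomMeasure ω
        (Metric.closedBall x (S.scale (2 * R) n ω))).toReal / n) atTop (𝓝 a) := by
      rw [S.randomMeasure_eq_map ω] at hmeas ⊢
      rw [ae_map_iff (S.measurable_point_mk ω).aemeasurable hmeas, ← S.randomMeasure_eq_map ω]
      exact hω
    filter_upwards [hx, ae_forall_measure_closedBall_pos (S.randomMeasure ω)] with x hx hpos
    exact tendsto_log_div_log_of_seq
      (φ := fun r => (S.randomMeasure ω).real (Metric.closedBall x r))
      (fun r r' hrr' => measureReal_mono (Metric.closedBall_subset_closedBall hrr'))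
      (fun r hr => ENNReal.toReal_pos (hpos r hr).ne' (measure_ne_top _ _))
      (fun r => measureReal_le_one) (S.antitone_scale hR2 ω) (fun n => S.scale_pos hR2 n ω)
      (S.tendsto_scale _ ω) hb.ne hωb hx
  obtain ⟨ω, hω⟩ := hdim.exists
  exact ⟨a / b, hω.mem_Icc, hdim⟩
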